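/- Let $K$ be a number field, let $G \subset \mathrm{GL}_m$ be a linear algebraic group defined over $K$ (given with a faithful $K$-defined representation; for instance an absolutely almost simple simply connected one), let $S$ be a set of places of $K$ containing all archimedean places, let $\mathcal{O}(S)$ be the ring of $S$-integers of $K$, and put $\Gamma = G(\mathcal{O}(S)) = G(K) \cap \mathrm{GL}_m(\mathcal{O}(S))$. For a nonzero ideal $\mathfrak{a} \subset \mathcal{O}(S)$ let $G(\mathcal{O}(S),\mathfrak{a})$ be the group of all elements of $\Gamma$ that are congruent to the identity matrix modulo $\mathfrak{a}$. Let $\widehat{G}^S$ and $\overline{G}^S$ be the (Hausdorff) completions of the group $G(K)$ with respect to the $S$-arithmetic topology, for which the finite index subgroups of $\Gamma$ form a fundamental system of neighborhoods of the identity, and the $S$-congruence topology, for which the congruence subgroups $G(\mathcal{O}(S),\mathfrak{a})$, $\mathfrak{a} \neq 0$, form such a system. Let $\pi \colon \widehat{G}^S \to \overline{G}^S$ be the continuous homomorphism that extends the identity map of $G(K)$, and let $C^S(G) = \ker \pi$ be the congruence kernel. For a subgroup $N$ of $\Gamma$, let $\overline{N}$ be its closure in $\overline{G}^S$, let $\overline{N}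 \cap \Gamma$ be the set of all elements of $\Gamma$ whose image in $\overline{G}^S$ lies in $\overline{N}$, and for $y \in \Gamma$ put $Z(N,y) = \{ t \in \Gamma \mid [y,t] \in N \}$, where $[y,t] = y t y^{-1} t^{-1}$. Finally, let $\Gamma^n = \{ \gamma^n \mid \gamma \in \Gamma \}$. Let $n \geq 1$. Assume that for every finite index normal subgroup $N$ of $\Gamma$ and every $y \in \overline{N} \cap \Gamma$ we have the inclusion $$Z(N,y)\,(\overline{N} \cap \Gamma) \supset \Gamma^n .$$ Then for every $x \in C^S(G)$ we have $$\pi\bigl(Z_{\widehat{G}^S}(x)\bigr) \supset \Gamma^n ,$$ where $Z_{\widehat{G}^S}(x)$ is the centralizer of $x$ in $\widehat{G}^S$ and $\Gamma^n$ is identified with its image in $\overline{G}^S$. -/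

import Mathlib

section Completion

open Filter Topology

variable (H : Type*) [Group H] [TopologicalSpace H] [IsTopologicalGroup H]

/-- The two-sided uniform structure of a topological group: the infimum of the left and the right
uniform structures. -/
abbrev twoSidedUniformSpace : UniformSpace H :=
  (IsTopologicalGroup.leftUniformSpace H ⊓ IsTopologicalGroup.rightUniformSpace H).replaceTopology
    (by rw [UniformSpace.toTopologicalSpace_inf]; exact (inf_idem _).symm)

/-- The (Hausdorff) completion of a topological group, that is, its completion with respect to the
two-sided uniform structure. -/
def GroupCompletion : Type _ := @UniformSpace.Completion H (twoSidedUniformSpace H)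

namespace GroupCompletion

attribute [local instance] twoSidedUniformSpace

instance : UniformSpace (GroupCompletion H) :=
  inferInstanceAs (UniformSpace (UniformSpace.Completion H))

instance : CompleteSpace (GroupCompletion H) :=
  inferInstanceAs (CompleteSpace (UniformSpace.Completion H))

instance : T0Space (GroupCompletion H) :=
  inferInstanceAs (T0Space (UniformSpace.Completion H))

variable {H}

/-- The canonical map from a topological group to its completion. -/
def ofFun (h : H) : GroupCompletion H := UniformSpace.Completion.coe' h

lemma isUniformInducing_ofFun : IsUniformInducing (ofFun : H → GroupCompletion H) :=
  UniformSpace.Completion.isUniformInducing_coe H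

lemma denseRange_ofFun : DenseRange (ofFun : H → GroupCompletion H) :=
  UniformSpace.Completion.denseRange_coe

lemma isDenseInducing_ofFun : IsDenseInducing (ofFun : H → GroupCompletion H) :=
  isUniformInducing_ofFun.isDenseInducing denseRange_ofFun

lemma cauchy_iff' (F : Filter H) : Cauchy F ↔ F.NeBot ∧
    Tendsto (fun p : H × H => p.1⁻¹ * p.2) (F ×ˢ F) (𝓝 1) ∧
    Tendsto (fun p : H × H => p.2 * p.1⁻¹) (F ×ˢ F) (𝓝 1) := by
  have : uniformity H = comap (fun p : H × H => p.1⁻¹ * p.2) (𝓝 1) ⊓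
      comap (fun p : H × H => p.2 * p.1⁻¹) (𝓝 1) := rfl
  rw [Cauchy, this, le_inf_iff, ← tendsto_iff_comap, ← tendsto_iff_comap]

lemma cauchy_inv {F : Filter H} (hF : Cauchy F) : Cauchy (map (fun h => h⁻¹) F) := by
  rw [cauchy_iff'] at hF ⊢
  obtain ⟨h0, h1, h2⟩ := hF
  refine ⟨h0.map _, ?_, ?_⟩
  · rw [prod_map_map_eq, tendsto_map'_iff]
    simpa [Function.comp_def] using h2.inv
  · rw [prod_map_map_eq, tendsto_map'_iff]
    simpa [Function.comp_def] using h1.inv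

/-- Conjugating a small element by the members of a Cauchy filter keeps it small. -/
lemma exists_conj {G : Filter H} (hG : Cauchy G) {V : Set H} (hV : V ∈ 𝓝 (1 : H)) :
    ∃ W ∈ 𝓝 (1 : H), ∀ᶠ y in G, ∀ w ∈ W, y⁻¹ * w * y ∈ V ∧ y * w * y⁻¹ ∈ V := by
  obtain ⟨h0, h1, h2⟩ := (cauchy_iff' G).1 hG
  have hc : Tendsto (fun p : H × H => p.1⁻¹ * p.2 * p.1) (𝓝 1 ×ˢ 𝓝 1) (𝓝 1) := by
    have : ContinuousAt (fun p : H × H => p.1⁻¹ * p.2 * p.1) (1, 1) := by fun_prop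
    simpa [ContinuousAt, nhds_prod_eq] using this
  obtain ⟨A, hA, B, hB, hAB⟩ := mem_prod_iff.1 (hc hV)
  have e1 : ∀ᶠ p : H × H in G ×ˢ G, p.1⁻¹ * p.2 ∈ A := h1 hA
  have e2 : ∀ᶠ p : H × H in G ×ˢ G, (p.2 * p.1⁻¹)⁻¹ ∈ A := by
    have := h2.inv
    rw [inv_one] at this
    exact this hA
  obtain ⟨y₀, hy₀⟩ := (e1.and e2).curry.exists
  have c1 : ∀ᶠ w in 𝓝 (1 : H), y₀⁻¹ * w * y₀ ∈ B := by
    have : Tendsto (fun w => y₀⁻¹ * w * y₀) (𝓝 1) (𝓝 (y₀⁻¹ * 1 * y₀)) :=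
      (by fun_prop : Continuous fun w => y₀⁻¹ * w * y₀).tendsto 1
    rw [mul_one, inv_mul_cancel] at this
    exact this hB
  have c2 : ∀ᶠ w in 𝓝 (1 : H), y₀ * w * y₀⁻¹ ∈ B := by
    have : Tendsto (fun w => y₀ * w * y₀⁻¹) (𝓝 1) (𝓝 (y₀ * 1 * y₀⁻¹)) :=
      (by fun_prop : Continuous fun w => y₀ * w * y₀⁻¹).tendsto 1
    rw [mul_one, mul_inv_cancel] at this
    exact this hB
  refine ⟨_, c1.and c2, hy₀.mono fun y hy w hw => ⟨?_, ?_⟩⟩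
  · have := hAB (Set.mk_mem_prod hy.1 hw.1)
    simpa [mul_assoc] using this
  · have := hAB (Set.mk_mem_prod hy.2 hw.2)
    simpa [mul_assoc] using this

lemma cauchy_mul {F G : Filter H} (hF : Cauchy F) (hG : Cauchy G) :
    Cauchy (map (fun p : H × H => p.1 * p.2) (F ×ˢ G)) := by
  have hF' := (cauchy_iff' F).1 hF
  have hG' := (cauchy_iff' G).1 hG
  have := hF'.1
  have := hG'.1
  rw [cauchy_iff']
  refine ⟨inferInstance, ?_, ?_⟩
  all_goals
    rw [prod_map_map_eq, tendsto_map'_iff]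
    intro U hU
    obtain ⟨V, hV, hVU⟩ := exists_nhds_one_split hU
  · obtain ⟨W, hW, hc⟩ := exists_conj hG hV
    have a1 : ∀ᶠ q : (H × H) × (H × H) in (F ×ˢ G) ×ˢ (F ×ˢ G), q.1.1⁻¹ * q.2.1 ∈ W :=
      (tendsto_fst.prodMap tendsto_fst).eventually (hF'.2.1 hW)
    have a2 : ∀ᶠ q : (H × H) × (H × H) in (F ×ˢ G) ×ˢ (F ×ˢ G), q.1.2⁻¹ * q.2.2 ∈ V :=
      (tendsto_snd.prodMap tendsto_snd).eventually (hG'.2.1 hV)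
    have a3 := (tendsto_snd.comp (tendsto_fst (f := F ×ˢ G) (g := F ×ˢ G))).eventually hc
    rw [mem_map]
    filter_upwards [a1, a2, a3] with q h1 h2 h3
    have := hVU _ (h3 _ h1).1 _ h2
    simpa [mul_assoc] using this
  · obtain ⟨W, hW, hc⟩ := exists_conj hF hV
    have a1 : ∀ᶠ q : (H × H) × (H × H) in (F ×ˢ G) ×ˢ (F ×ˢ G), q.2.2 * q.1.2⁻¹ ∈ W :=
      (tendsto_snd.prodMap tendsto_snd).eventually (hG'.2.2 hW)
    have a2 : ∀ᶠ q : (H × H) × (H × H) in (F ×ˢ G) ×ˢ (F ×ˢ G), q.2.1 * q.1.1⁻¹ ∈ V :=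
      (tendsto_fst.prodMap tendsto_fst).eventually (hF'.2.2 hV)
    have a3 := (tendsto_fst.comp (tendsto_fst (f := F ×ˢ G) (g := F ×ˢ G))).eventually hc
    rw [mem_map]
    filter_upwards [a1, a2, a3] with q h1 h2 h3
    have := hVU _ h2 _ (h3 _ h1).2
    simpa [mul_assoc] using this

lemma cauchy_comap_ofFun (x : GroupCompletion H) : Cauchy (comap (ofFun : H → _) (𝓝 x)) :=
  cauchy_nhds.comap' isUniformInducing_ofFun.comap_uniformity.le
    (isDenseInducing_ofFun.comap_nhds_neBot x)

lemma exists_tendsto {α : Type*} {f : α → H} {F : Filter α} (h : Cauchy (map f F)) :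
    ∃ c, Tendsto (fun a => ofFun (f a)) F (𝓝 c) := by
  obtain ⟨c, hc⟩ := CompleteSpace.complete
    (h.map isUniformInducing_ofFun.uniformContinuous)
  exact ⟨c, by rwa [map_map] at hc⟩

instance : One (GroupCompletion H) := ⟨ofFun 1⟩

/-- Inversion and multiplication are the continuous extensions of those of the group. -/
noncomputable instance : Inv (GroupCompletion H) :=
  ⟨isDenseInducing_ofFun.extend fun h => ofFun h⁻¹⟩

noncomputable instance : Mul (GroupCompletion H) :=
  ⟨fun x y => (isDenseInducing_ofFun.prodMap isDenseInducing_ofFun).extend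
    (fun p : H × H => ofFun (p.1 * p.2)) (x, y)⟩

instance : ContinuousInv (GroupCompletion H) where
  continuous_inv := isDenseInducing_ofFun.continuous_extend fun x =>
    exists_tendsto (cauchy_inv (cauchy_comap_ofFun x))

instance : ContinuousMul (GroupCompletion H) where
  continuous_mul := (isDenseInducing_ofFun.prodMap isDenseInducing_ofFun).continuous_extend
    fun x => exists_tendsto (f := fun p : H × H => p.1 * p.2) (by
      have : comap (Prod.map ofFun ofFun) (𝓝 x) =
          comap (ofFun : H → _) (𝓝 x.1) ×ˢ comap (ofFun : H → _) (𝓝 x.2) := by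
        rw [nhds_prod_eq, prod_comap_comap_eq]; rfl
      rw [this]
      exact cauchy_mul (cauchy_comap_ofFun _) (cauchy_comap_ofFun _))

lemma continuous_ofFun : Continuous (ofFun : H → GroupCompletion H) :=
  isDenseInducing_ofFun.continuous

lemma ofFun_inv (h : H) : ofFun h⁻¹ = (ofFun h)⁻¹ :=
  (isDenseInducing_ofFun.extend_eq (continuous_ofFun.comp continuous_inv) h).symm

lemma ofFun_mul (g h : H) : ofFun (g * h) = ofFun g * ofFun h :=
  ((isDenseInducing_ofFun.prodMap isDenseInducing_ofFun).extend_eq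
    (continuous_ofFun.comp continuous_mul) (g, h)).symm

noncomputable instance : Group (GroupCompletion H) where
  mul_assoc x y z := by
    refine denseRange_ofFun.induction_on₃ (isClosed_eq (by fun_prop) (by fun_prop)) ?_ x y z
    intro a b c
    simp only [← ofFun_mul, mul_assoc]
  one_mul x := by
    refine denseRange_ofFun.induction_on x (isClosed_eq (by fun_prop) (by fun_prop)) ?_
    intro a
    exact (ofFun_mul 1 a).symm.trans (by rw [one_mul])
  mul_one x := by
    refine denseRange_ofFun.induction_on x (isClosed_eq (by fun_prop) (by fun_prop)) ?_
    intro a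
    exact (ofFun_mul a 1).symm.trans (by rw [mul_one])
  inv_mul_cancel x := by
    refine denseRange_ofFun.induction_on x (isClosed_eq (by fun_prop) (by fun_prop)) ?_
    intro a
    rw [← ofFun_inv, ← ofFun_mul, inv_mul_cancel]
    rfl

instance : IsTopologicalGroup (GroupCompletion H) where

/-- The canonical homomorphism from a topological group to its completion. -/
def of : H →* GroupCompletion H where
  toFun := ofFun
  map_one' := rfl
  map_mul' := ofFun_mul

variable {H' : Type*} [Group H'] [TopologicalSpace H'] [IsTopologicalGroup H']

lemma uniformContinuous_hom (f : H →* H') (hf : Continuous f) : UniformContinuous f := by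
  have hf1 : Tendsto f (𝓝 1) (𝓝 1) := by simpa using hf.tendsto 1
  have e : uniformity H' = comap (fun p : H' × H' => p.1⁻¹ * p.2) (𝓝 1) ⊓
      comap (fun p : H' × H' => p.2 * p.1⁻¹) (𝓝 1) := rfl
  have e' : uniformity H = comap (fun p : H × H => p.1⁻¹ * p.2) (𝓝 1) ⊓
      comap (fun p : H × H => p.2 * p.1⁻¹) (𝓝 1) := rfl
  rw [UniformContinuous, e, e', tendsto_inf, tendsto_comap_iff, tendsto_comap_iff]
  constructor
  · refine Tendsto.mono_left ?_ inf_le_left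
    simpa [Function.comp_def] using hf1.comp (tendsto_comap (f := fun p : H × H => p.1⁻¹ * p.2))
  · refine Tendsto.mono_left ?_ inf_le_right
    simpa [Function.comp_def] using hf1.comp (tendsto_comap (f := fun p : H × H => p.2 * p.1⁻¹))

/-- The underlying function of `GroupCompletion.map`. -/
noncomputable def mapFun (f : H → H') : GroupCompletion H → GroupCompletion H' :=
  UniformSpace.Completion.map f

lemma continuous_mapFun (f : H → H') : Continuous (mapFun f) :=
  UniformSpace.Completion.continuous_map

lemma mapFun_ofFun (f : H →* H') (hf : Continuous f) (h : H) :
    mapFun f (ofFun h) = ofFun (f h) :=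
  UniformSpace.Completion.map_coe (uniformContinuous_hom f hf) h

/-- The homomorphism between completions which extends a continuous homomorphism `f`. -/
noncomputable def map (f : H →* H') (hf : Continuous f) :
    GroupCompletion H →* GroupCompletion H' where
  toFun := mapFun f
  map_one' := (mapFun_ofFun f hf 1).trans (by rw [map_one]; rfl)
  map_mul' x y := by
    have hc := continuous_mapFun (H := H) (H' := H') f
    refine denseRange_ofFun.induction_on₂ (isClosed_eq (by fun_prop) (by fun_prop)) ?_ x y
    intro a b
    rw [← ofFun_mul, mapFun_ofFun f hf, mapFun_ofFun f hf, mapFun_ofFun f hf, map_mul, ofFun_mul]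

end GroupCompletion

end Completion

noncomputable section ArithmeticGroups

open IsDedekindDomain NumberField Matrix

/-- The ring of `S`-integers modulo a nonzero ideal is finite. -/
lemma finite_quotient_integer {K : Type*} [Field K] [NumberField K]
    (S : Set (HeightOneSpectrum (𝓞 K))) {a : Ideal (S.integer K)} (ha : a ≠ ⊥) :
    Finite (S.integer K ⧸ a) := by
  obtain ⟨b, hb, hb0⟩ := Submodule.exists_mem_ne_zero_of_ne_bot ha
  -- a positive integer `m` in the ideal
  obtain ⟨m, hm, hma⟩ : ∃ m : ℕ, m ≠ 0 ∧ (m : S.integer K) ∈ a := by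
    obtain ⟨r, s, hs, hrs⟩ := IsFractionRing.div_surjective (A := 𝓞 K) (b : K)
    have hs0 : (algebraMap (𝓞 K) K s) ≠ 0 := by
      simpa using nonZeroDivisors.ne_zero hs
    have hr0 : r ≠ 0 := by
      rintro rfl
      apply hb0
      ext
      simp [← hrs]
    have hfin : Finite (𝓞 K ⧸ Ideal.span {r}) :=
      Ring.HasFiniteQuotients.finiteQuotient (by simpa using hr0)
    refine ⟨Nat.card (𝓞 K ⧸ Ideal.span {r}), Nat.card_pos.ne', ?_⟩
    have h1 : ((Nat.card (𝓞 K ⧸ Ideal.span {r}) : ℕ) : 𝓞 K) ∈ Ideal.span {r} := by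
      rw [← Ideal.Quotient.eq_zero_iff_mem, map_natCast, ← nsmul_one]
      exact card_nsmul_eq_zero'
    obtain ⟨c, hc⟩ := Ideal.mem_span_singleton.1 h1
    have h2 : ((Nat.card (𝓞 K ⧸ Ideal.span {r}) : ℕ) : S.integer K) =
        algebraMap (𝓞 K) (S.integer K) (s * c) * b := by
      ext
      have : ((Nat.card (𝓞 K ⧸ Ideal.span {r}) : ℕ) : K) = algebraMap (𝓞 K) K (r * c) := by
        rw [← hc, map_natCast]
      push_cast
      rw [this, ← hrs]
      simp only [map_mul]
      field_simp
    rw [h2]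
    exact a.mul_mem_left _ hb
  by_contra hinf
  rw [not_finite_iff_infinite] at hinf
  obtain ⟨t, ht⟩ := Infinite.exists_subset_card_eq (S.integer K ⧸ a)
    (m ^ Module.finrank ℚ K + 1)
  let f : t → S.integer K := fun i => Quotient.out i.1
  have hf : ∀ i : t, Ideal.Quotient.mk a (f i) = i.1 := fun i => Quotient.out_eq i.1
  let M : Submodule ℤ (S.integer K) := Submodule.span ℤ (Set.range f)
  have : Module.Finite ℤ M := Module.Finite.span_of_finite ℤ (Set.finite_range f)
  have : Module.Free ℤ M := Module.free_of_finite_type_torsion_free'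
  let B := Module.Free.chooseBasis ℤ M
  have hr : Fintype.card (Module.Free.ChooseBasisIndex ℤ M) ≤ Module.finrank ℚ K := by
    have h1 : LinearIndependent ℤ fun i => ((B i : S.integer K) : K) := by
      have := B.linearIndependent.map' ((S.integer K).val.toLinearMap.restrictScalars ℤ ∘ₗ M.subtype)
        (LinearMap.ker_eq_bot.2 (Subtype.val_injective.comp Subtype.val_injective))
      exact this
    have h2 := (LinearIndependent.iff_fractionRing ℤ ℚ).1 h1
    exact h2.fintype_card_le_finrank
  have : NeZero m := ⟨hm⟩
  let g : t → (Module.Free.ChooseBasisIndex ℤ M → ZMod m) := fun i k =>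
    (B.repr ⟨f i, Submodule.subset_span ⟨i, rfl⟩⟩ k : ZMod m)
  have hg : Function.Injective g := by
    intro i j hij
    apply Subtype.ext
    rw [← hf, ← hf, Ideal.Quotient.eq]
    set u : M := ⟨f i, Submodule.subset_span ⟨i, rfl⟩⟩ with hu
    set v : M := ⟨f j, Submodule.subset_span ⟨j, rfl⟩⟩ with hv
    have hd : ∀ k, (m : ℤ) ∣ B.repr (u - v) k := by
      intro k
      have := congrFun hij k
      rw [map_sub, Finsupp.sub_apply, ← ZMod.intCast_eq_intCast_iff_dvd_sub]
      exact this.symm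
    have : (f i - f j) = ((u - v : M) : S.integer K) := rfl
    rw [this, ← B.sum_repr (u - v), Submodule.coe_sum]
    refine Ideal.sum_mem _ fun k _ => ?_
    obtain ⟨c, hc⟩ := hd k
    rw [hc, Submodule.coe_smul, mul_smul, zsmul_eq_mul]
    simpa using a.mul_mem_right _ hma
  have := Fintype.card_le_of_injective g hg
  rw [Fintype.card_fun, ZMod.card, Fintype.card_coe, ht] at this
  have h3 := Nat.pow_le_pow_right (Nat.pos_of_ne_zero hm) hr
  omega

/-- A linear algebraic group over the field `K` together with a faithful `K`-representation of
degree `m`, i.e. (in characteristic zero) a subgroup of `GL_m` over an algebraic closure of `K`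
which is the zero set of polynomials in the matrix entries with coefficients in `K`. -/
structure LinearAlgebraicGroup (K : Type*) [Field K] (m : ℕ) where
  /-- the defining equations -/
  equations : Set (MvPolynomial (Fin m × Fin m) K)
  /-- the points over the algebraic closure -/
  geometricPoints : Subgroup (GL (Fin m) (AlgebraicClosure K))
  mem_geometricPoints (g : GL (Fin m) (AlgebraicClosure K)) : g ∈ geometricPoints ↔
    ∀ p ∈ equations, MvPolynomial.aeval (fun ij : Fin m × Fin m => g.val ij.1 ij.2) p = 0

namespace LinearAlgebraicGroup

variable {K : Type*} [Field K] {m : ℕ}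

/-- The group `G(K)` of `K`-rational points. -/
def points (G : LinearAlgebraicGroup K m) : Subgroup (GL (Fin m) K) :=
  G.geometricPoints.comap (GeneralLinearGroup.map (algebraMap K (AlgebraicClosure K)))

variable [NumberField K]

/-- `GL_m(𝒪(S), 𝔞)`, as a subgroup of `GL_m(K)`: the matrices over the ring `𝒪(S)` of `S`-integers
that are invertible over `𝒪(S)` and congruent to the identity matrix modulo `𝔞`. -/
def glCongruence (m : ℕ) (S : Set (HeightOneSpectrum (𝓞 K))) (a : Ideal (S.integer K)) :
    Subgroup (GL (Fin m) K) :=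
  (GeneralLinearGroup.map (n := Fin m) (Ideal.Quotient.mk a)).ker.map
    (GeneralLinearGroup.map (algebraMap (S.integer K) K))

variable (G : LinearAlgebraicGroup K m) (S : Set (HeightOneSpectrum (𝓞 K)))

/-- The group `Γ = G(𝒪(S)) = G(K) ∩ GL_m(𝒪(S))`. -/
def integralPoints : Subgroup G.points :=
  (GeneralLinearGroup.map (n := Fin m) (algebraMap (S.integer K) K)).range.subgroupOf G.points

/-- The congruence subgroup `G(𝒪(S), 𝔞) = G(K) ∩ GL_m(𝒪(S), 𝔞)` of level `𝔞`. -/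
def congruenceSubgroup (a : Ideal (S.integer K)) : Subgroup G.points :=
  (glCongruence m S a).subgroupOf G.points

variable {S} in
lemma mem_glCongruence {a : Ideal (S.integer K)} (g : GL (Fin m) K) :
    g ∈ glCongruence m S a ↔ ∀ i j,
      (g.val - 1) i j ∈ Submodule.map (Algebra.linearMap (S.integer K) K) a ∧
      (g⁻¹.val - 1) i j ∈ Submodule.map (Algebra.linearMap (S.integer K) K) a := by
  have key : ∀ u : GL (Fin m) (S.integer K),
      u ∈ (GeneralLinearGroup.map (n := Fin m) (Ideal.Quotient.mk a)).ker →
      ∀ i j, (((GeneralLinearGroup.map (algebraMap (S.integer K) K) u).val - 1 :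
        Matrix (Fin m) (Fin m) K) i j) ∈ Submodule.map (Algebra.linearMap (S.integer K) K) a := by
    intro u hu i j
    refine ⟨(u.val - 1) i j, ?_, ?_⟩
    · have := congrArg (fun v : GL (Fin m) (S.integer K ⧸ a) => v.val i j) hu
      rw [SetLike.mem_coe, ← Ideal.Quotient.eq_zero_iff_mem, Matrix.sub_apply, map_sub, sub_eq_zero]
      refine this.trans ?_
      simp [one_apply]
    · simp only [Algebra.linearMap_apply, Matrix.sub_apply, map_sub, one_apply]
      split_ifs <;> simp
  constructor
  · rintro ⟨u, hu, rfl⟩ i j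
    refine ⟨key u hu i j, ?_⟩
    rw [← map_inv]
    exact key u⁻¹ (inv_mem hu) i j
  · intro h
    choose f hf hf' using fun i j => (h i j).1
    choose f' hg hg' using fun i j => (h i j).2
    have e1 : (1 + Matrix.of f).map (algebraMap (S.integer K) K) = g.val := by
      ext i j
      have := hf' i j
      rw [Algebra.linearMap_apply, Matrix.sub_apply] at this
      rw [map_apply, Matrix.add_apply, map_add, of_apply, this]
      simp [one_apply]
    have e2 : (1 + Matrix.of f').map (algebraMap (S.integer K) K) = g⁻¹.val := by
      ext i j
      have := hg' i j
      rw [Algebra.linearMap_apply, Matrix.sub_apply] at this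
      rw [map_apply, Matrix.add_apply, map_add, of_apply, this]
      simp [one_apply]
    have hinj : Function.Injective fun M : Matrix (Fin m) (Fin m) (S.integer K) =>
        M.map (algebraMap (S.integer K) K) :=
      Matrix.map_injective (FaithfulSMul.algebraMap_injective _ _)
    refine ⟨⟨1 + Matrix.of f, 1 + Matrix.of f', hinj ?_, hinj ?_⟩, ?_, ?_⟩
    · simp only [Matrix.map_mul, e1, e2, Matrix.map_one _ (map_zero _) (map_one _)]
      simp
    · simp only [Matrix.map_mul, e1, e2, Matrix.map_one _ (map_zero _) (map_one _)]
      simp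
    · apply Units.ext
      ext i j
      have : Ideal.Quotient.mk a (f i j) = 0 := Ideal.Quotient.eq_zero_iff_mem.2 (hf i j)
      simp [this, one_apply]
    · exact Units.ext e1

lemma congruenceSubgroup_mono {a b : Ideal (S.integer K)} (h : a ≤ b) :
    G.congruenceSubgroup S a ≤ G.congruenceSubgroup S b := by
  intro x hx
  have hx' := (mem_glCongruence x.1).1 hx
  exact (mem_glCongruence x.1).2 fun i j =>
    ⟨Submodule.map_mono h (hx' i j).1, Submodule.map_mono h (hx' i j).2⟩

lemma congruenceSubgroup_le (a : Ideal (S.integer K)) :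
    G.congruenceSubgroup S a ≤ G.integralPoints S := by
  rintro x ⟨u, -, hu⟩
  exact ⟨u, hu⟩

lemma congruenceSubgroup_top : G.congruenceSubgroup S ⊤ = G.integralPoints S := by
  refine le_antisymm (G.congruenceSubgroup_le S ⊤) ?_
  rintro x ⟨u, hu⟩
  refine ⟨u, ?_, hu⟩
  apply Units.ext
  ext i j
  have : Subsingleton (S.integer K ⧸ (⊤ : Ideal (S.integer K))) :=
    Ideal.Quotient.subsingleton_iff.2 rfl
  exact Subsingleton.elim _ _

/-- The congruence subgroups have finite index. -/
lemma relIndex_congruenceSubgroup {a : Ideal (S.integer K)} (ha : a ≠ ⊥) :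
    (G.congruenceSubgroup S a).relIndex (G.integralPoints S) ≠ 0 := by
  have := finite_quotient_integer S ha
  refine Subgroup.relIndex_comap_ne_zero _ ?_
  have hinj : Function.Injective
      (GeneralLinearGroup.map (n := Fin m) (algebraMap (S.integer K) K)) :=
    Units.map_injective (Matrix.map_injective (FaithfulSMul.algebraMap_injective _ _))
  rw [glCongruence, MonoidHom.range_eq_map, Subgroup.relIndex_map_map_of_injective _ _ hinj,
    Subgroup.relIndex_ker]
  have : Finite (GL (Fin m) (S.integer K ⧸ a)) :=
    Finite.of_injective _ Units.val_injective
  exact Nat.card_pos.ne'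

/-- Conjugation by a rational point is continuous for the congruence topology. -/
lemma exists_conj_congruenceSubgroup (x : G.points) {a : Ideal (S.integer K)} (ha : a ≠ ⊥) :
    ∃ b : Ideal (S.integer K), b ≠ ⊥ ∧
      ∀ y ∈ G.congruenceSubgroup S b, x * y * x⁻¹ ∈ G.congruenceSubgroup S a := by
  classical
  obtain ⟨d, hd⟩ := IsLocalization.exist_integer_multiples_of_finset (nonZeroDivisors (𝓞 K))
    ((Finset.univ.image fun ij : Fin m × Fin m => x.1.val ij.1 ij.2) ∪
      (Finset.univ.image fun ij : Fin m × Fin m => x.1⁻¹.val ij.1 ij.2))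
  set D : S.integer K := algebraMap (𝓞 K) (S.integer K) d with hD
  have hD0 : D ≠ 0 := by
    rw [hD, Ne, FaithfulSMul.algebraMap_eq_zero_iff]
    exact nonZeroDivisors.ne_zero d.2
  have hint : ∀ z : K, IsLocalization.IsInteger (𝓞 K) ((d : 𝓞 K) • z) →
      ∃ c : S.integer K, (c : K) = D * z := by
    rintro z ⟨c, hc⟩
    refine ⟨algebraMap _ _ c, ?_⟩
    rw [Algebra.smul_def] at hc
    exact hc
  have h1 : ∀ i j, ∃ c : S.integer K, (c : K) = D * x.1.val i j := fun i j =>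
    hint _ (hd _ (Finset.mem_union_left _ (Finset.mem_image_of_mem
      (fun ij : Fin m × Fin m => x.1.val ij.1 ij.2) (Finset.mem_univ (i, j)))))
  have h2 : ∀ i j, ∃ c : S.integer K, (c : K) = D * x.1⁻¹.val i j := fun i j =>
    hint _ (hd _ (Finset.mem_union_right _ (Finset.mem_image_of_mem
      (fun ij : Fin m × Fin m => x.1⁻¹.val ij.1 ij.2) (Finset.mem_univ (i, j)))))
  choose p hp using h1
  choose q hq using h2
  have main : ∀ M : Matrix (Fin m) (Fin m) K, (∀ i j, M i j ∈
      Submodule.map (Algebra.linearMap (S.integer K) K) (Ideal.span {D * D} * a)) → ∀ i j,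
      (x.1.val * M * x.1⁻¹.val) i j ∈ Submodule.map (Algebra.linearMap (S.integer K) K) a := by
    intro M hM i j
    rw [mul_apply]
    refine Submodule.sum_mem _ fun k _ => ?_
    rw [mul_apply, Finset.sum_mul]
    refine Submodule.sum_mem _ fun l _ => ?_
    obtain ⟨c, hc, hcM⟩ := hM l k
    obtain ⟨c', hc', rfl⟩ := Ideal.mem_span_singleton_mul.1 hc
    refine ⟨p i l * q k j * c', a.mul_mem_left _ hc', ?_⟩
    rw [← hcM]
    simp only [Algebra.linearMap_apply, map_mul]
    have e1 : algebraMap (S.integer K) K (p i l) = algebraMap (S.integer K) K D * x.1.val i l :=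
      hp i l
    have e2 : algebraMap (S.integer K) K (q k j) = algebraMap (S.integer K) K D * x.1⁻¹.val k j :=
      hq k j
    rw [e1, e2]
    ring
  refine ⟨Ideal.span {D * D} * a, ?_, fun y hy => ?_⟩
  · simp [ha, hD0]
  · have hy' := (mem_glCongruence y.1).1 hy
    refine (mem_glCongruence _).2 fun i j => ⟨?_, ?_⟩
    · have := main _ (fun i j => (hy' i j).1) i j
      rw [mul_sub, sub_mul, mul_one, ← Units.val_mul x.1 x.1⁻¹, mul_inv_cancel] at this
      exact this
    · have := main _ (fun i j => (hy' i j).2) i j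
      rw [mul_sub, sub_mul, mul_one, ← Units.val_mul x.1 x.1⁻¹, mul_inv_cancel,
        ← Units.val_mul, ← Units.val_mul] at this
      have e : ((x * y * x⁻¹ : G.points) : GL (Fin m) K)⁻¹ = x.1 * y.1⁻¹ * x.1⁻¹ := by
        simp [mul_assoc]
      change (((x * y * x⁻¹ : G.points) : GL (Fin m) K)⁻¹.val - 1 : Matrix (Fin m) (Fin m) K) i j ∈ _
      rw [e]
      exact this

/-- The finite index subgroups of `Γ`, as a fundamental system of neighbourhoods of the identity
in `G(K)`. -/
abbrev arithmeticBasis : GroupFilterBasis G.points where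
  sets := {U | ∃ N : Subgroup G.points, N ≤ G.integralPoints S ∧
    N.relIndex (G.integralPoints S) ≠ 0 ∧ U = N}
  nonempty := ⟨_, G.integralPoints S, le_rfl, by simp, rfl⟩
  inter_sets := by
    rintro _ _ ⟨N, hN, hN', rfl⟩ ⟨M, hM, hM', rfl⟩
    exact ⟨_, ⟨N ⊓ M, inf_le_left.trans hN, Subgroup.relIndex_inf_ne_zero hN' hM', rfl⟩, by simp⟩
  one' := by
    rintro _ ⟨N, -, -, rfl⟩
    exact N.one_mem
  mul' := by
    rintro _ ⟨N, hN, hN', rfl⟩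
    exact ⟨_, ⟨N, hN, hN', rfl⟩, by simp⟩
  inv' := by
    rintro _ ⟨N, hN, hN', rfl⟩
    exact ⟨_, ⟨N, hN, hN', rfl⟩, fun y hy => N.inv_mem hy⟩
  conj' := by
    rintro x _ ⟨N, hN, hN', rfl⟩
    obtain ⟨b, hb, hb'⟩ := G.exists_conj_congruenceSubgroup S x (a := ⊤) top_ne_bot
    rw [congruenceSubgroup_top] at hb'
    let c : G.points →* G.points := (MulAut.conj x).toMonoidHom
    refine ⟨_, ⟨N.comap c ⊓ G.integralPoints S, inf_le_right, ?_, rfl⟩, fun y hy => hy.1⟩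
    rw [Subgroup.inf_relIndex_right]
    refine Subgroup.relIndex_ne_zero_trans (Subgroup.relIndex_comap_ne_zero c hN') ?_
    intro h0
    exact G.relIndex_congruenceSubgroup S hb
      (Subgroup.relIndex_eq_zero_of_le_left (fun y hy => hb' y hy) h0)

/-- The congruence subgroups, as a fundamental system of neighbourhoods of the identity
in `G(K)`. -/
abbrev congruenceBasis : GroupFilterBasis G.points where
  sets := {U | ∃ a : Ideal (S.integer K), a ≠ ⊥ ∧ U = G.congruenceSubgroup S a}
  nonempty := ⟨_, ⊤, top_ne_bot, rfl⟩
  inter_sets := by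
    rintro _ _ ⟨a, ha, rfl⟩ ⟨b, hb, rfl⟩
    have hab : a * b ≠ ⊥ := by simp [ha, hb]
    refine ⟨G.congruenceSubgroup S (a * b), ⟨a * b, hab, rfl⟩, Set.subset_inter ?_ ?_⟩
    · exact G.congruenceSubgroup_mono S Ideal.mul_le_left
    · exact G.congruenceSubgroup_mono S Ideal.mul_le_right
  one' := by
    rintro _ ⟨a, -, rfl⟩
    exact one_mem _
  mul' := by
    rintro _ ⟨a, ha, rfl⟩
    exact ⟨_, ⟨a, ha, rfl⟩, by simp⟩
  inv' := by
    rintro _ ⟨a, ha, rfl⟩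
    exact ⟨_, ⟨a, ha, rfl⟩, fun y hy => (G.congruenceSubgroup S a).inv_mem hy⟩
  conj' := by
    rintro x _ ⟨a, ha, rfl⟩
    obtain ⟨b, hb, hb'⟩ := G.exists_conj_congruenceSubgroup S x ha
    exact ⟨_, ⟨b, hb, rfl⟩, hb'⟩

/-- The `S`-arithmetic topology on `G(K)`. -/
abbrev arithmeticTopology : TopologicalSpace G.points := (G.arithmeticBasis S).topology

/-- The `S`-congruence topology on `G(K)`. -/
abbrev congruenceTopology : TopologicalSpace G.points := (G.congruenceBasis S).topology

/-- The completion of `G(K)` for the `S`-arithmetic topology. -/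
abbrev ArithmeticCompletion : Type _ :=
  @GroupCompletion G.points _ (G.arithmeticTopology S) (G.arithmeticBasis S).isTopologicalGroup

/-- The completion of `G(K)` for the `S`-congruence topology. -/
abbrev CongruenceCompletion : Type _ :=
  @GroupCompletion G.points _ (G.congruenceTopology S) (G.congruenceBasis S).isTopologicalGroup

/-- The canonical map from `G(K)` to its `S`-congruence completion. -/
def toCongruenceCompletion : G.points →* G.CongruenceCompletion S :=
  @GroupCompletion.of G.points _ (G.congruenceTopology S) (G.congruenceBasis S).isTopologicalGroup

/-- The `S`-arithmetic topology is finer than the `S`-congruence topology. -/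
lemma continuous_id_arithmetic_congruence :
    @Continuous _ _ (G.arithmeticTopology S) (G.congruenceTopology S) (MonoidHom.id G.points) := by
  refine @continuous_of_tendsto_nhds_one G.points (G.arithmeticTopology S) _
    (G.arithmeticBasis S).isTopologicalGroup _ _ _ (G.congruenceTopology S)
    (G.congruenceBasis S).isTopologicalGroup.toContinuousMul _ _ (MonoidHom.id G.points) ?_
  rw [(G.arithmeticBasis S).nhds_one_hasBasis.tendsto_iff (G.congruenceBasis S).nhds_one_hasBasis]
  rintro _ ⟨a, ha, rfl⟩
  exact ⟨_, ⟨_, G.congruenceSubgroup_le S a, G.relIndex_congruenceSubgroup S ha, rfl⟩,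
    fun x hx => hx⟩

/-- The canonical homomorphism `π` from the `S`-arithmetic to the `S`-congruence completion: the
continuous extension of the identity map of `G(K)`. -/
def completionMap : G.ArithmeticCompletion S →* G.CongruenceCompletion S :=
  @GroupCompletion.map G.points _ (G.arithmeticTopology S) (G.arithmeticBasis S).isTopologicalGroup
    G.points _ (G.congruenceTopology S) (G.congruenceBasis S).isTopologicalGroup
    (MonoidHom.id G.points) (G.continuous_id_arithmetic_congruence S)

/-- The congruence kernel `C^S(G) = ker π`. -/
def congruenceKernel : Subgroup (G.ArithmeticCompletion S) :=
  (G.completionMap S).ker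

/-- For a subgroup `N` of `Γ`, the set `N̄ ∩ Γ`, where `N̄` is the closure of `N` in the
`S`-congruence completion. -/
def closureInter (N : Subgroup (G.integralPoints S)) : Set (G.integralPoints S) :=
  {γ | G.toCongruenceCompletion S γ ∈
    closure ((fun ν : G.integralPoints S => G.toCongruenceCompletion S ν) '' N)}

end LinearAlgebraicGroup

end ArithmeticGroups

/-- `Z(N, y)`, the set of all `t` whose commutator with `y` lies in `N`. -/
def centralizerMod {Γ : Type*} [Group Γ] (N : Subgroup Γ) (y : Γ) : Set Γ :=
  {t | y * t * y⁻¹ * t⁻¹ ∈ N}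

open IsDedekindDomain NumberField
open scoped Pointwise

/-! Write `Γ̂` and `N̂` for the closures of `Γ` and `N` in the arithmetic completion, `N̄` for the
closure of `N` in the congruence completion. `Γ̂` is compact and contains the congruence kernel,
and the `N̂` form a basis of neighborhoods of `1`. Given `x` in the congruence kernel and `N`,
choose `y ∈ Γ` with `x ∈ y N̂`. Since `π x = 1`, `y` lies in `N̄ ∩ Γ`, so an `n`-th power factors
as `t c` with `[y, t] ∈ N` and `c ∈ N̄ ∩ Γ`: thus `t` commutes with `x` modulo `N̂` and lifts the
`n`-th power modulo `N̄`. By compactness of `Γ̂` some `z` has both properties for all `N` at once,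
and then `z` centralizes `x` and maps to the `n`-th power. -/

section TopologicalGroup

open Topology

variable {Γ E E' : Type*} [Group Γ] [Group E] [TopologicalSpace E] [IsTopologicalGroup E]
  [Group E'] [TopologicalSpace E'] [IsTopologicalGroup E']

lemma map_mem_topologicalClosure_map_comp (ψ : Γ →* E) {π : E →* E'} (hπ : Continuous π)
    {N : Subgroup Γ} {u : E} (hu : u ∈ (N.map ψ).topologicalClosure) :
    π u ∈ (N.map (π.comp ψ)).topologicalClosure := by
  refine map_mem_closure hπ hu ?_
  rintro _ ⟨ν, hν, rfl⟩
  exact ⟨ν, hν, rfl⟩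

lemma conj_mem_topologicalClosure_map (ψ : Γ →* E) {N : Subgroup Γ} (hN : N.Normal) (γ : Γ)
    {u : E} (hu : u ∈ (N.map ψ).topologicalClosure) :
    ψ γ * u * (ψ γ)⁻¹ ∈ (N.map ψ).topologicalClosure := by
  refine map_mem_closure (f := fun v => ψ γ * v * (ψ γ)⁻¹) (by fun_prop) hu ?_
  rintro _ ⟨ν, hν, rfl⟩
  exact ⟨γ * ν * γ⁻¹, hN.conj_mem ν hν γ, by simp only [map_mul, map_inv]⟩

lemma eq_one_of_forall_mem_topologicalClosure_map [T2Space E'] {ψ : Γ →* E}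
    {ι : Type*} {p : ι → Prop} {N : ι → Subgroup Γ}
    (hbasis : (𝓝 (1 : E)).HasBasis p fun i => ((N i).map ψ).topologicalClosure)
    {π : E →* E'} (hπ : Continuous π) {u : E'}
    (hu : ∀ i, p i → u ∈ ((N i).map (π.comp ψ)).topologicalClosure) : u = 1 := by
  by_contra hne
  obtain ⟨W, ⟨hW, hWclosed⟩, huW⟩ :=
    (closed_nhds_basis (1 : E')).mem_iff.1 (isOpen_compl_singleton.mem_nhds (Ne.symm hne))
  obtain ⟨i, hi, hiW⟩ := hbasis.mem_iff.1 (hπ.continuousAt (by simpa only [map_one] using hW))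
  refine huW (closure_minimal ?_ hWclosed (hu i hi)) rfl
  rintro _ ⟨ν, hν, rfl⟩
  exact hiW (Subgroup.le_topologicalClosure _ ⟨ν, hν, rfl⟩)

lemma exists_inv_mul_mem_topologicalClosure_map {ψ : Γ →* E} {N : Subgroup Γ}
    (hN : ((N.map ψ).topologicalClosure : Set E) ∈ 𝓝 1) {x : E}
    (hx : x ∈ ψ.range.topologicalClosure) :
    ∃ y : Γ, (ψ y)⁻¹ * x ∈ (N.map ψ).topologicalClosure := by
  have hnear : {v : E | v⁻¹ * x ∈ (N.map ψ).topologicalClosure} ∈ 𝓝 x :=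
    (by fun_prop : Continuous fun v : E => v⁻¹ * x).continuousAt (by simpa using hN)
  obtain ⟨_, hy, y, rfl⟩ := mem_closure_iff_nhds.1 hx _ hnear
  exact ⟨y, hy⟩

/-- The lifts to the closure of `ψ(Γ)` of an element `b`, up to the closure of `π(ψ(N))`, which
commute with `x` up to the closure of `ψ(N)`. As `N` shrinks, these sets decrease to the set of
genuine lifts of `b` in the centralizer of `x`. -/
def centralizingLifts (ψ : Γ →* E) (π : E →* E') (x : E) (b : E') (N : Subgroup Γ) : Set E :=
  {z | z ∈ ψ.range.topologicalClosure ∧ x * z * x⁻¹ * z⁻¹ ∈ (N.map ψ).topologicalClosure ∧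
    (π z)⁻¹ * b ∈ (N.map (π.comp ψ)).topologicalClosure}

lemma centralizingLifts_mono (ψ : Γ →* E) (π : E →* E') (x : E) (b : E') :
    Monotone (centralizingLifts ψ π x b) :=
  fun _ _ hMN _ ⟨hz, hcomm, hlift⟩ =>
    ⟨hz, Subgroup.topologicalClosure_mono (Subgroup.map_mono hMN) hcomm,
      Subgroup.topologicalClosure_mono (Subgroup.map_mono hMN) hlift⟩

lemma isClosed_centralizingLifts (ψ : Γ →* E) {π : E →* E'} (hπ : Continuous π) (x : E) (b : E')
    (N : Subgroup Γ) : IsClosed (centralizingLifts ψ π x b N) :=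
  (Subgroup.isClosed_topologicalClosure _).inter <|
    ((Subgroup.isClosed_topologicalClosure _).preimage
      (by fun_prop : Continuous fun z => x * z * x⁻¹ * z⁻¹)).inter <|
    (Subgroup.isClosed_topologicalClosure _).preimage
      (by fun_prop : Continuous fun z => (π z)⁻¹ * b)

lemma centralizingLifts_nonempty {ψ : Γ →* E} {π : E →* E'} (hπ : Continuous π)
    {N : Subgroup Γ} (hN : N.Normal) (hNnhds : ((N.map ψ).topologicalClosure : Set E) ∈ 𝓝 1)
    {x : E} (hx : x ∈ π.ker) (hxΓ : x ∈ ψ.range.topologicalClosure) {γ : Γ}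
    (h : ∀ y ∈ (N.map (π.comp ψ)).topologicalClosure.comap (π.comp ψ),
      γ ∈ centralizerMod N y * ((N.map (π.comp ψ)).topologicalClosure.comap (π.comp ψ) : Set Γ)) :
    (centralizingLifts ψ π x (π (ψ γ)) N).Nonempty := by
  obtain ⟨y, hyx⟩ := exists_inv_mul_mem_topologicalClosure_map hNnhds hxΓ
  have hy : π (ψ y) ∈ (N.map (π.comp ψ)).topologicalClosure := by
    have := map_mem_topologicalClosure_map_comp ψ hπ hyx
    rwa [map_mul, MonoidHom.mem_ker.1 hx, mul_one, map_inv, inv_mem_iff] at this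
  obtain ⟨t, ht, c, hc, rfl⟩ := h y hy
  refine ⟨ψ t, Subgroup.le_topologicalClosure _ ⟨t, rfl⟩, ?_, ?_⟩
  · -- For `x = ψ y * u`, the commutator `[x, ψ t]` is `ψ [y, t]` up to conjugates of `u` and `u⁻¹`.
    set u := (ψ y)⁻¹ * x with hu
    have hcomm : x * ψ t * x⁻¹ * (ψ t)⁻¹ = (ψ y * u * (ψ y)⁻¹) *
        (ψ (y * t) * u⁻¹ * (ψ (y * t))⁻¹) * ψ (y * t * y⁻¹ * t⁻¹) := by
      simp only [hu, map_mul, map_inv]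
      group
    rw [hcomm]
    exact mul_mem (mul_mem (conj_mem_topologicalClosure_map ψ hN y hyx)
      (conj_mem_topologicalClosure_map ψ hN (y * t) (inv_mem hyx)))
      (Subgroup.le_topologicalClosure _ ⟨_, ht, rfl⟩)
  · rw [map_mul, map_mul, inv_mul_cancel_left]
    exact hc

lemma exists_forall_mem_centralizingLifts {ψ : Γ →* E} {π : E →* E'} (hπ : Continuous π)
    (hcompact : IsCompact (ψ.range.topologicalClosure : Set E)) {x : E} {b : E'}
    (hne : ∀ N : FiniteIndexNormalSubgroup Γ, (centralizingLifts ψ π x b N).Nonempty) :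
    ∃ z, ∀ N : FiniteIndexNormalSubgroup Γ, z ∈ centralizingLifts ψ π x b N := by
  have : Nonempty (FiniteIndexNormalSubgroup Γ) := ⟨.ofSubgroup ⊤⟩
  have hclosed (N : FiniteIndexNormalSubgroup Γ) := isClosed_centralizingLifts ψ hπ x b N
  have hmono : Monotone fun N : FiniteIndexNormalSubgroup Γ => centralizingLifts ψ π x b N :=
    (centralizingLifts_mono ψ π x b).comp fun _ _ hMN => hMN
  obtain ⟨z, hz⟩ := IsCompact.nonempty_iInter_of_directed_nonempty_isCompact_isClosed _
    hmono.directed_ge hne (fun N => hcompact.of_isClosed_subset (hclosed N) fun _ hz => hz.1)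
    hclosed
  exact ⟨z, Set.mem_iInter.1 hz⟩

theorem proposition2p3_general [T2Space E] [T2Space E'] {ψ : Γ →* E} {π : E →* E'} {φ : Γ →* E'}
    (hφ : π.comp ψ = φ) (hπ : Continuous π)
    (hcompact : IsCompact (ψ.range.topologicalClosure : Set E))
    (hbasis : (𝓝 (1 : E)).HasBasis (fun _ : FiniteIndexNormalSubgroup Γ => True)
      fun N => (N.toSubgroup.map ψ).topologicalClosure)
    {A : Set Γ}
    (h : ∀ N : Subgroup Γ, N.Normal → N.FiniteIndex →
      ∀ y ∈ (N.map φ).topologicalClosure.comap φ,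
        A ⊆ centralizerMod N y * ((N.map φ).topologicalClosure.comap φ : Set Γ))
    {x : E} (hx : x ∈ π.ker) (hxΓ : x ∈ ψ.range.topologicalClosure) :
    φ '' A ⊆ (Subgroup.centralizer {x}).map π := by
  subst hφ
  rintro _ ⟨γ, hγ, rfl⟩
  obtain ⟨z, hz⟩ := exists_forall_mem_centralizingLifts hπ hcompact fun N =>
    centralizingLifts_nonempty hπ N.isNormal' (hbasis.mem_of_mem trivial) hx hxΓ
      fun y hy => h N N.isNormal' N.isFiniteIndex' y hy hγ
  have hcomm : x * z * x⁻¹ * z⁻¹ = 1 :=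
    eq_one_of_forall_mem_topologicalClosure_map hbasis (π := MonoidHom.id E) continuous_id
      fun N _ => (hz N).2.1
  have hlift : (π z)⁻¹ * π (ψ γ) = 1 :=
    eq_one_of_forall_mem_topologicalClosure_map hbasis hπ fun N _ => (hz N).2.2
  refine ⟨z, Subgroup.mem_centralizer_singleton_iff.2 ?_, inv_mul_eq_one.1 hlift⟩
  exact (mul_inv_eq_iff_eq_mul.1 (mul_inv_eq_one.1 hcomm)).symm

end TopologicalGroup

namespace GroupCompletion

open Filter Topology

variable {H : Type*} [Group H] [TopologicalSpace H] [IsTopologicalGroup H]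

section ProfiniteBasis

variable {Γ : Subgroup H} (hbasis : (𝓝 (1 : H)).HasBasis
  (fun _ : FiniteIndexNormalSubgroup Γ => True) fun N => N.toSubgroup.map Γ.subtype)

include hbasis

attribute [local instance] twoSidedUniformSpace in
lemma totallyBounded_of_hasBasis_finiteIndexNormalSubgroup : TotallyBounded (Γ : Set H) := by
  intro d hd
  obtain ⟨A, ⟨U, hU, hUA⟩, B, ⟨V, hV, hVB⟩, rfl⟩ := hd
  obtain ⟨N, -, hN⟩ := hbasis.mem_iff.1 (inter_mem hU hV)
  refine ⟨Set.range fun q : Γ ⧸ N.toSubgroup => (q.out : H), Set.finite_range _, fun γ hγ => ?_⟩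
  set ρ : Γ := (QuotientGroup.mk (s := N.toSubgroup) ⟨γ, hγ⟩).out
  have hleft : (⟨γ, hγ⟩ : Γ)⁻¹ * ρ ∈ N.toSubgroup :=
    QuotientGroup.eq.1 (QuotientGroup.out_eq' _).symm
  have hright : ρ * (⟨γ, hγ⟩ : Γ)⁻¹ ∈ N.toSubgroup := N.isNormal'.mem_comm hleft
  exact Set.mem_biUnion ⟨_, rfl⟩ ⟨hUA (hN ⟨_, hleft, rfl⟩).1, hVB (hN ⟨_, hright, rfl⟩).2⟩

lemma isCompact_topologicalClosure_range :
    IsCompact ((of.comp Γ.subtype).range.topologicalClosure : Set (GroupCompletion H)) := by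
  let := twoSidedUniformSpace H
  have hbounded : TotallyBounded (ofFun '' (Γ : Set H)) :=
    (totallyBounded_of_hasBasis_finiteIndexNormalSubgroup hbasis).image
      isUniformInducing_ofFun.uniformContinuous
  have hrange : ((of.comp Γ.subtype).range : Set (GroupCompletion H)) = ofFun '' (Γ : Set H) := by
    rw [MonoidHom.range_comp, Subgroup.range_subtype]
    rfl
  rw [Subgroup.topologicalClosure_coe, hrange]
  exact hbounded.closure.isCompact_of_isClosed isClosed_closure

lemma hasBasis_nhds_one :
    (𝓝 (1 : GroupCompletion H)).HasBasis (fun _ : FiniteIndexNormalSubgroup Γ => True)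
      fun N => (N.toSubgroup.map (of.comp Γ.subtype)).topologicalClosure := by
  refine (hbasis.hasBasis_of_isDenseInducing isDenseInducing_ofFun).congr (fun _ => Iff.rfl)
    fun N _ => ?_
  rw [← Subgroup.map_map]
  rfl

end ProfiniteBasis

variable {H' : Type*} [Group H'] [TopologicalSpace H'] [IsTopologicalGroup H']

lemma map_comp_of {f : H →* H'} (hf : Continuous f) : (map f hf).comp of = of.comp f :=
  MonoidHom.ext (mapFun_ofFun f hf)

lemma mem_topologicalClosure_range_of_mem_ker_map {Γ : Subgroup H} {f : H →* H'}
    (hf : Continuous f) {V : Set H'} (hV : V ∈ 𝓝 1) (hVΓ : f ⁻¹' V ⊆ Γ) {x : GroupCompletion H}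
    (hx : x ∈ (map f hf).ker) : x ∈ (of.comp Γ.subtype).range.topologicalClosure := by
  rw [isDenseInducing_ofFun.isInducing.nhds_eq_comap] at hV
  obtain ⟨W, hW, hWV⟩ := hV
  have hnear : mapFun f ⁻¹' W ∈ 𝓝 x :=
    (continuous_mapFun f).continuousAt (by rwa [show mapFun f x = ofFun 1 from hx])
  refine mem_closure_iff_nhds.2 fun U hU => ?_
  obtain ⟨_, ⟨hyU, hyW⟩, y, rfl⟩ :=
    mem_closure_iff_nhds.1 (denseRange_ofFun x) _ (inter_mem hU hnear)
  rw [Set.mem_preimage, mapFun_ofFun f hf] at hyW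
  exact ⟨_, hyU, ⟨y, hVΓ (hWV hyW)⟩, rfl⟩

end GroupCompletion

namespace LinearAlgebraicGroup

open Topology

variable {K : Type*} [Field K] [NumberField K] {m : ℕ} (G : LinearAlgebraicGroup K m)
  (S : Set (HeightOneSpectrum (𝓞 K)))

lemma hasBasis_nhds_one_arithmeticTopology :
    (@nhds _ (G.arithmeticTopology S) 1).HasBasis
      (fun _ : FiniteIndexNormalSubgroup (G.integralPoints S) => True)
      fun N => N.toSubgroup.map (G.integralPoints S).subtype := by
  refine (G.arithmeticBasis S).nhds_one_hasBasis.to_hasBasis ?_ fun N _ => ?_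
  · rintro _ ⟨N, -, hN, rfl⟩
    have : (N.subgroupOf (G.integralPoints S)).FiniteIndex := ⟨hN⟩
    refine ⟨.ofSubgroup (N.subgroupOf (G.integralPoints S)).normalCore, trivial, ?_⟩
    rintro _ ⟨ν, hν, rfl⟩
    exact Subgroup.normalCore_le (N.subgroupOf (G.integralPoints S)) hν
  · refine ⟨_, ⟨_, Subgroup.map_subtype_le _, ?_, rfl⟩, subset_rfl⟩
    rw [Subgroup.relIndex, Subgroup.subgroupOf,
      Subgroup.comap_map_eq_self_of_injective (Subgroup.subtype_injective _)]
    exact N.isFiniteIndex'.index_ne_zero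

lemma integralPoints_mem_nhds_one_congruenceTopology :
    (G.integralPoints S : Set G.points) ∈ @nhds _ (G.congruenceTopology S) 1 :=
  Filter.mem_of_superset
    ((G.congruenceBasis S).nhds_one_hasBasis.mem_of_mem ⟨⊤, top_ne_bot, rfl⟩)
    (G.congruenceSubgroup_le S ⊤)

/-- The canonical map from `G(K)` to its `S`-arithmetic completion. -/
noncomputable def toArithmeticCompletion : G.points →* G.ArithmeticCompletion S :=
  @GroupCompletion.of G.points _ (G.arithmeticTopology S) (G.arithmeticBasis S).isTopologicalGroup

lemma completionMap_comp_toArithmeticCompletion :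
    (G.completionMap S).comp (G.toArithmeticCompletion S) = G.toCongruenceCompletion S :=
  @GroupCompletion.map_comp_of G.points _ (G.arithmeticTopology S)
    (G.arithmeticBasis S).isTopologicalGroup G.points _ (G.congruenceTopology S)
    (G.congruenceBasis S).isTopologicalGroup (MonoidHom.id G.points)
    (G.continuous_id_arithmetic_congruence S)

lemma continuous_completionMap : Continuous (G.completionMap S) :=
  @GroupCompletion.continuous_mapFun G.points _ (G.arithmeticTopology S)
    (G.arithmeticBasis S).isTopologicalGroup G.points _ (G.congruenceTopology S)
    (G.congruenceBasis S).isTopologicalGroup (MonoidHom.id G.points)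

lemma isCompact_topologicalClosure_integralPoints :
    IsCompact (((G.toArithmeticCompletion S).comp
      (G.integralPoints S).subtype).range.topologicalClosure : Set (G.ArithmeticCompletion S)) :=
  @GroupCompletion.isCompact_topologicalClosure_range G.points _ (G.arithmeticTopology S)
    (G.arithmeticBasis S).isTopologicalGroup _ (G.hasBasis_nhds_one_arithmeticTopology S)

lemma hasBasis_nhds_one_arithmeticCompletion :
    (𝓝 (1 : G.ArithmeticCompletion S)).HasBasis
      (fun _ : FiniteIndexNormalSubgroup (G.integralPoints S) => True)
      fun N => (N.toSubgroup.map ((G.toArithmeticCompletion S).comp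
        (G.integralPoints S).subtype)).topologicalClosure :=
  @GroupCompletion.hasBasis_nhds_one G.points _ (G.arithmeticTopology S)
    (G.arithmeticBasis S).isTopologicalGroup _ (G.hasBasis_nhds_one_arithmeticTopology S)

lemma congruenceKernel_le_topologicalClosure_integralPoints :
    G.congruenceKernel S ≤ ((G.toArithmeticCompletion S).comp
      (G.integralPoints S).subtype).range.topologicalClosure := fun _ hx =>
  @GroupCompletion.mem_topologicalClosure_range_of_mem_ker_map G.points _ (G.arithmeticTopology S)
    (G.arithmeticBasis S).isTopologicalGroup G.points _ (G.congruenceTopology S)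
    (G.congruenceBasis S).isTopologicalGroup _ _ (G.continuous_id_arithmetic_congruence S) _
    (G.integralPoints_mem_nhds_one_congruenceTopology S) subset_rfl _ hx

end LinearAlgebraicGroup

theorem proposition2p3 {K : Type*} [Field K] [NumberField K] {m : ℕ}
    (G : LinearAlgebraicGroup K m) (S : Set (HeightOneSpectrum (𝓞 K))) (n : ℕ) (hn : 1 ≤ n)
    (h : ∀ N : Subgroup (G.integralPoints S), N.Normal → N.FiniteIndex →
      ∀ y ∈ G.closureInter S N,
        Set.range (fun γ : G.integralPoints S => γ ^ n) ⊆
          centralizerMod N y * G.closureInter S N) :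
    ∀ x ∈ G.congruenceKernel S,
      Set.range (fun γ : G.integralPoints S => G.toCongruenceCompletion S (γ ^ n)) ⊆
        (Subgroup.centralizer {x}).map (G.completionMap S) := by
  rintro x hx _ ⟨γ, rfl⟩
  exact proposition2p3_general (φ := (G.toCongruenceCompletion S).comp (G.integralPoints S).subtype)
    (congrArg (·.comp (G.integralPoints S).subtype) (G.completionMap_comp_toArithmeticCompletion S))
    (G.continuous_completionMap S) (G.isCompact_topologicalClosure_integralPoints S)
    (G.hasBasis_nhds_one_arithmeticCompletion S) h hx
    (G.congruenceKernel_le_topologicalClosure_integralPoints S hx) ⟨γ ^ n, ⟨γ, rfl⟩, rfl⟩
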